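/- Let $G$ be a (real, finite-dimensional) Lie group and let $M$ be a homogeneous space of $G$, i.e. a smooth manifold with a smooth transitive action of $G$ (for example $M=G/H$ with $H$ a closed subgroup of $G$). Let $g$ and $\bar g$ be two $G$-invariant smooth pseudo-Riemannian metrics on $M$, each of arbitrary signature. Suppose that $\bar g$ is geodesically equivalent to $g$, i.e. every geodesic of $g$ is a reparameterized geodesic of $\bar g$. Then $g$ and $\bar g$ are affinely equivalent, i.e. their Levi-Civita connections coincide. -/

import Mathlib

open Bundle
open scoped Manifold ContDiff Topology

set_option maxSynthPendingDepth 3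

noncomputable section

/-- A smooth pseudo-Riemannian metric (of any signature) on a smooth manifold `M` modelled on `E`:
a smooth section of symmetric, nondegenerate bilinear forms on the tangent spaces. -/
structure PseudoRiemannianMetric (E : Type*) [NormedAddCommGroup E] [NormedSpace ℝ E]
    (M : Type*) [TopologicalSpace M] [ChartedSpace E M] [IsManifold 𝓘(ℝ, E) ∞ M] where
  val (x : M) : TangentSpace 𝓘(ℝ, E) x →L[ℝ] TangentSpace 𝓘(ℝ, E) x →L[ℝ] ℝ
  symm (x : M) (v w : TangentSpace 𝓘(ℝ, E) x) : val x v w = val x w v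
  nondegenerate (x : M) (v : TangentSpace 𝓘(ℝ, E) x) (hv : ∀ w, val x v w = 0) : v = 0
  contMDiff : ContMDiff 𝓘(ℝ, E) (𝓘(ℝ, E).prod 𝓘(ℝ, E →L[ℝ] E →L[ℝ] ℝ)) ∞
    (fun x ↦ TotalSpace.mk' (E →L[ℝ] E →L[ℝ] ℝ) x (val x))

namespace PseudoRiemannianMetric

variable {E : Type*} [NormedAddCommGroup E] [NormedSpace ℝ E]
  {M : Type*} [TopologicalSpace M] [ChartedSpace E M] [IsManifold 𝓘(ℝ, E) ∞ M]

/-- The differential at `x` of a chart `e`. -/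
def chartDeriv (e : OpenPartialHomeomorph M E) (x : M) : TangentSpace 𝓘(ℝ, E) x →L[ℝ] E :=
  mfderiv 𝓘(ℝ, E) 𝓘(ℝ, E) e x

/-- The differential at `y` of the inverse of a chart `e`; it sends the standard basis of the model
space to the coordinate frame. -/
def chartSymmDeriv (e : OpenPartialHomeomorph M E) (y : E) :
    E →L[ℝ] TangentSpace 𝓘(ℝ, E) (e.symm y) :=
  mfderiv 𝓘(ℝ, E) 𝓘(ℝ, E) e.symm y

/-- The metric in the chart `e`, i.e. the components `g_ij` at the point with coordinates `y`, as a
bilinear form on the model space. -/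
def inChart (g : PseudoRiemannianMetric E M) (e : OpenPartialHomeomorph M E) (y : E) :
    E →L[ℝ] E →L[ℝ] ℝ :=
  (ContinuousLinearMap.precomp ℝ (chartSymmDeriv e y)) ∘L (g.val (e.symm y) ∘L chartSymmDeriv e y)

theorem inChart_apply (g : PseudoRiemannianMetric E M) (e : OpenPartialHomeomorph M E)
    (y u v : E) : g.inChart e y u v =
      g.val (e.symm y) (chartSymmDeriv e y u) (chartSymmDeriv e y v) := rfl

/-- Christoffel symbols of the first kind in the chart `e`:
`Γ(u, v, z) = (∂_u g(v, z) + ∂_v g(u, z) - ∂_z g(u, v)) / 2`. -/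
def christoffelFirst (g : PseudoRiemannianMetric E M) (e : OpenPartialHomeomorph M E)
    (y : E) : E →L[ℝ] E →L[ℝ] E →L[ℝ] ℝ :=
  letI D : E →L[ℝ] E →L[ℝ] E →L[ℝ] ℝ := fderiv ℝ (g.inChart e) y
  letI T : (E →L[ℝ] E →L[ℝ] ℝ) →L[ℝ] (E →L[ℝ] E →L[ℝ] ℝ) :=
    (ContinuousLinearMap.flipₗᵢ ℝ E E ℝ).toContinuousLinearEquiv.toContinuousLinearMap
  (1 / 2 : ℝ) • (D + D.flip - T ∘L D.flip)

theorem christoffelFirst_apply (g : PseudoRiemannianMetric E M) (e : OpenPartialHomeomorph M E)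
    (y u v z : E) : g.christoffelFirst e y u v z =
      1 / 2 * (fderiv ℝ (g.inChart e) y u v z + fderiv ℝ (g.inChart e) y v u z
        - fderiv ℝ (g.inChart e) y z u v) := rfl

/-- Christoffel symbols `Γ^i_jk` of the Levi-Civita connection in the chart `e`, as a bilinear map on
the model space: the last index of the symbols of the first kind is raised with the inverse of the
metric. -/
def christoffel (g : PseudoRiemannianMetric E M) (e : OpenPartialHomeomorph M E)
    (y : E) : E →L[ℝ] E →L[ℝ] E :=
  ContinuousLinearMap.compL ℝ E (E →L[ℝ] ℝ) E (g.inChart e y).inverse ∘L g.christoffelFirst e y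

theorem christoffel_apply (g : PseudoRiemannianMetric E M) (e : OpenPartialHomeomorph M E)
    (y u v : E) : g.christoffel e y u v =
      (g.inChart e y).inverse (g.christoffelFirst e y u v) := rfl

/-- The components of a vector field in the chart `e`. -/
def vectorInChart (e : OpenPartialHomeomorph M E) (X : Π x : M, TangentSpace 𝓘(ℝ, E) x)
    (y : E) : E :=
  chartDeriv e (e.symm y) (X (e.symm y))

theorem differentiableAt_vectorInChart {σ : Π x : M, TangentSpace 𝓘(ℝ, E) x} {x : M}
    (hσ : MDiffAt (T% σ) x) :
    DifferentiableAt ℝ (vectorInChart (chartAt E x) σ) (chartAt E x x) := by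
  have h1 := (mdifferentiableAt_section 𝓘(ℝ, E) σ).1 hσ
  have h2 : MDiffAt (chartAt E x).symm (chartAt E x x) :=
    mdifferentiableAt_atlas_symm (chart_mem_atlas E x) (mem_chart_target E x)
  have hx : (chartAt E x).symm (chartAt E x x) = x := (chartAt E x).left_inv (mem_chart_source E x)
  rw [← hx] at h1
  have h3 := h1.comp (chartAt E x x) h2
  rw [mdifferentiableAt_iff_differentiableAt] at h3
  refine h3.congr_of_eventuallyEq ?_
  filter_upwards [(chartAt E x).open_target.mem_nhds (mem_chart_target E x)] with y hy
  have hy' : (chartAt E x).symm y ∈ (chartAt E x).source := (chartAt E x).map_target hy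
  simp only [Function.comp, hx, vectorInChart, chartDeriv]
  have := TangentBundle.continuousLinearMapAt_trivializationAt (I := 𝓘(ℝ, E)) (x₀ := x) hy'
  have h4 := congrArg (fun L ↦ L (σ ((chartAt E x).symm y))) this
  simp only [Trivialization.continuousLinearMapAt_apply] at h4
  rw [Trivialization.linearMapAt_apply, if_pos] at h4
  · rw [h4]
    congr 1
  · simpa using hy'

theorem chartDeriv_isInvertible (x : M) :
    (chartDeriv (chartAt E x) x : TangentSpace 𝓘(ℝ, E) x →L[ℝ] E).IsInvertible :=
  isInvertible_mfderiv_extChartAt (I := 𝓘(ℝ, E)) (mem_extChartAt_source x)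

/-- The covariant derivative `∇_v X` at `x`, computed in the preferred chart at `x` as
`∂_v X + Γ(v, X)`. -/
def covAt (g : PseudoRiemannianMetric E M) (X : Π x : M, TangentSpace 𝓘(ℝ, E) x) (x : M) :
    TangentSpace 𝓘(ℝ, E) x →L[ℝ] TangentSpace 𝓘(ℝ, E) x :=
  letI e := chartAt E x
  (chartDeriv e x).inverse ∘L (fderiv ℝ (vectorInChart e X) (e x)
    + (g.christoffel e (e x)).flip (vectorInChart e X (e x))) ∘L chartDeriv e x

theorem covAt_apply (g : PseudoRiemannianMetric E M) (X : Π x : M, TangentSpace 𝓘(ℝ, E) x) (x : M)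
    (v : TangentSpace 𝓘(ℝ, E) x) :
    g.covAt X x v = (chartDeriv (chartAt E x) x).inverse
      (fderiv ℝ (vectorInChart (chartAt E x) X) (chartAt E x x) (chartDeriv (chartAt E x) x v)
        + g.christoffel (chartAt E x) (chartAt E x x) (chartDeriv (chartAt E x) x v)
          (vectorInChart (chartAt E x) X (chartAt E x x))) := rfl

set_option linter.unusedSectionVars false in
theorem vectorInChart_self (X : Π x : M, TangentSpace 𝓘(ℝ, E) x) (x : M) :
    vectorInChart (chartAt E x) X (chartAt E x x) = chartDeriv (chartAt E x) x (X x) := by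
  have hx : (chartAt E x).symm (chartAt E x x) = x := (chartAt E x).left_inv (mem_chart_source E x)
  rw [vectorInChart, hx]

theorem hasFDerivAt_comp_chart_symm {F : Type*} [NormedAddCommGroup F] [NormedSpace ℝ F]
    {f : M → F} {x : M} (hf : MDiffAt f x) :
    HasFDerivAt (f ∘ (chartAt E x).symm)
      (mvfderiv 𝓘(ℝ, E) f x ∘L (chartDeriv (chartAt E x) x).inverse) (chartAt E x x) := by
  have h := hf.hasMFDerivAt.2
  have h1 : (chartDeriv (chartAt E x) x : TangentSpace 𝓘(ℝ, E) x →L[ℝ] E)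
      = ContinuousLinearMap.id ℝ E := mfderiv_extChartAt_self (I := 𝓘(ℝ, E)) (x := x)
  have h2 : (chartDeriv (chartAt E x) x).inverse = ContinuousLinearMap.id ℝ E := by
    rw [h1]; exact ContinuousLinearMap.inverse_id
  rw [h2]
  simp only [mfld_simps] at h
  exact hasFDerivWithinAt_univ.1 h

/-- The Levi-Civita connection of `g`. The theorems `leviCivita_torsion` and `leviCivita_metric` below
confirm that it is torsion-free and compatible with `g`. -/
def leviCivita (g : PseudoRiemannianMetric E M) :
    CovariantDerivative 𝓘(ℝ, E) E (TangentSpace 𝓘(ℝ, E) : M → Type _) where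
  toFun := g.covAt
  isCovariantDerivativeOnUniv :=
    { add := by
        intro X Y x hX hY _
        ext v
        have h : vectorInChart (chartAt E x) (X + Y) =
            vectorInChart (chartAt E x) X + vectorInChart (chartAt E x) Y := by
          funext y
          exact map_add (chartDeriv (chartAt E x) ((chartAt E x).symm y)) _ _
        rw [add_apply, covAt_apply, covAt_apply, covAt_apply, h,
          fderiv_add (differentiableAt_vectorInChart hX) (differentiableAt_vectorInChart hY)]
        rw [← map_add]
        congr 1
        simp only [Pi.add_apply, map_add, add_apply]
        abel
      leibniz := by
        intro X f x hX hf _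
        ext v
        have hx : (chartAt E x).symm (chartAt E x x) = x :=
          (chartAt E x).left_inv (mem_chart_source E x)
        have h : vectorInChart (chartAt E x) (f • X) =
            (f ∘ (chartAt E x).symm) • vectorInChart (chartAt E x) X := by
          funext y
          exact map_smul (chartDeriv (chartAt E x) ((chartAt E x).symm y)) _ _
        have hd := hasFDerivAt_comp_chart_symm hf
        rw [add_apply, covAt_apply, h,
          fderiv_smul hd.differentiableAt (differentiableAt_vectorInChart hX), hd.fderiv]
        have hi (w : TangentSpace 𝓘(ℝ, E) x) : (chartDeriv (chartAt E x) x).inverse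
          (chartDeriv (chartAt E x) x w) = w := (chartDeriv_isInvertible x).inverse_apply_self w
        simp only [add_apply, smul_apply, Pi.smul_apply', ContinuousLinearMap.comp_apply,
          ContinuousLinearMap.smulRight_apply, Function.comp, hx, covAt_apply, map_add, map_smul, vectorInChart_self, hi]
        module }

theorem christoffel_symm (g : PseudoRiemannianMetric E M) (e : OpenPartialHomeomorph M E)
    (y u v : E) : g.christoffel e y u v = g.christoffel e y v u := by
  have h (z : E) : (fderiv ℝ (g.inChart e) y z).flip = fderiv ℝ (g.inChart e) y z := by
    have h1 : (ContinuousLinearMap.flipₗᵢ ℝ E E ℝ) ∘ g.inChart e = g.inChart e := by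
      funext y
      ext u v
      simp [inChart_apply, g.symm]
    conv_rhs => rw [← h1, LinearIsometryEquiv.comp_fderiv]
    rfl
  rw [christoffel_apply, christoffel_apply]
  congr 1
  ext z
  rw [christoffelFirst_apply, christoffelFirst_apply, ← h z, ContinuousLinearMap.flip_apply, h z]
  ring

theorem chartSymmDeriv_chartDeriv {e : OpenPartialHomeomorph M E} (he : e ∈ atlas E M) {y : E}
    (hy : y ∈ e.target) (v : TangentSpace 𝓘(ℝ, E) (e.symm y)) :
    chartSymmDeriv e y (chartDeriv e (e.symm y) v) = v := by
  have h := (mdifferentiable_of_mem_atlas (I := 𝓘(ℝ, E)) he).symm_comp_deriv (e.map_target hy)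
  rw [e.right_inv hy] at h
  exact congrArg (fun L : TangentSpace 𝓘(ℝ, E) (e.symm y) →L[ℝ] TangentSpace 𝓘(ℝ, E) (e.symm y)
    ↦ L v) h

theorem chartDeriv_chartSymmDeriv {e : OpenPartialHomeomorph M E} (he : e ∈ atlas E M) {y : E}
    (hy : y ∈ e.target) (v : E) :
    chartDeriv e (e.symm y) (chartSymmDeriv e y v) = v :=
  congrArg (fun L : E →L[ℝ] E ↦ L v)
    ((mdifferentiable_of_mem_atlas (I := 𝓘(ℝ, E)) he).comp_symm_deriv hy)

theorem inChart_chartDeriv (g : PseudoRiemannianMetric E M) {e : OpenPartialHomeomorph M E}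
    (he : e ∈ atlas E M) {x : M} (hx : x ∈ e.source) (u v : TangentSpace 𝓘(ℝ, E) x) :
    g.inChart e (e x) (chartDeriv e x u) (chartDeriv e x v) = g.val x u v := by
  have key (y : E) (hy : y ∈ e.target) (u v : TangentSpace 𝓘(ℝ, E) (e.symm y)) :
      g.inChart e y (chartDeriv e (e.symm y) u) (chartDeriv e (e.symm y) v)
        = g.val (e.symm y) u v := by
    rw [inChart_apply, chartSymmDeriv_chartDeriv he hy, chartSymmDeriv_chartDeriv he hy]
  have h := key (e x) (e.map_source hx)
  rw [e.left_inv hx] at h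
  exact h u v

theorem inChart_isInvertible [FiniteDimensional ℝ E] (g : PseudoRiemannianMetric E M)
    {e : OpenPartialHomeomorph M E} (he : e ∈ atlas E M) {y : E} (hy : y ∈ e.target) :
    (g.inChart e y).IsInvertible := by
  have hinj : Function.Injective (g.inChart e y) := by
    rw [injective_iff_map_eq_zero]
    intro u hu
    have h0 : chartSymmDeriv e y u = 0 := by
      refine g.nondegenerate _ _ fun w ↦ ?_
      have := congrArg (fun L : E →L[ℝ] ℝ ↦ L (chartDeriv e (e.symm y) w)) hu
      simpa [inChart_apply, chartSymmDeriv_chartDeriv he hy] using this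
    rw [← chartDeriv_chartSymmDeriv he hy u, h0, map_zero]
  have hd : Module.finrank ℝ E = Module.finrank ℝ (E →L[ℝ] ℝ) := by
    rw [← (LinearMap.toContinuousLinearMap (𝕜 := ℝ) (E := E) (F' := ℝ)).finrank_eq]
    exact (Subspace.dual_finrank_eq (K := ℝ) (V := E)).symm
  refine ⟨(LinearEquiv.ofInjectiveOfFinrankEq (g.inChart e y : E →ₗ[ℝ] (E →L[ℝ] ℝ))
    hinj hd).toContinuousLinearEquiv, ?_⟩
  ext; rfl

theorem inChart_christoffel [FiniteDimensional ℝ E] (g : PseudoRiemannianMetric E M)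
    {e : OpenPartialHomeomorph M E} (he : e ∈ atlas E M) {y : E} (hy : y ∈ e.target) (u v z : E) :
    g.inChart e y (g.christoffel e y u v) z = g.christoffelFirst e y u v z := by
  rw [christoffel_apply, (g.inChart_isInvertible he hy).self_apply_inverse]

theorem inChart_symm (g : PseudoRiemannianMetric E M) (e : OpenPartialHomeomorph M E) (y u v : E) :
    g.inChart e y u v = g.inChart e y v u := g.symm _ _ _

theorem fderiv_inChart_symm (g : PseudoRiemannianMetric E M) (e : OpenPartialHomeomorph M E)
    (y z u v : E) : fderiv ℝ (g.inChart e) y z u v = fderiv ℝ (g.inChart e) y z v u := by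
  have h1 : (ContinuousLinearMap.flipₗᵢ ℝ E E ℝ) ∘ g.inChart e = g.inChart e := by
    funext y
    ext u v
    exact g.symm _ _ _
  conv_lhs => rw [← h1, LinearIsometryEquiv.comp_fderiv]
  rfl

theorem inChart_differentiableAt [FiniteDimensional ℝ E] (g : PseudoRiemannianMetric E M) (x : M) :
    DifferentiableAt ℝ (g.inChart (chartAt E x)) (chartAt E x x) := by
  have h1 := (contMDiffAt_section _).1 (g.contMDiff x)
  have h2 : MDiffAt (chartAt E x).symm (chartAt E x x) :=
    mdifferentiableAt_atlas_symm (chart_mem_atlas E x) (mem_chart_target E x)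
  have hx : (chartAt E x).symm (chartAt E x x) = x := (chartAt E x).left_inv (mem_chart_source E x)
  have h1 := h1.mdifferentiableAt (by simp)
  rw [← hx] at h1
  have h3 := h1.comp (chartAt E x x) h2
  rw [mdifferentiableAt_iff_differentiableAt] at h3
  refine h3.congr_of_eventuallyEq ?_
  filter_upwards [(chartAt E x).open_target.mem_nhds (mem_chart_target E x)] with y hy
  have hy' : (chartAt E x).symm y ∈ (chartAt E x).source := (chartAt E x).map_target hy
  ext u v
  simp only [Function.comp, hx]
  rw [hom_trivializationAt_apply]
  dsimp only
  rw [inCoordinates_apply_eq₂ (by simpa using hy') (by simpa using hy') (by simp)]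
  have h5 := TangentBundle.symmL_trivializationAt (I := 𝓘(ℝ, E)) (x₀ := x) hy'
  have h6 (u : E) : (trivializationAt E (TangentSpace 𝓘(ℝ, E)) x).symm ((chartAt E x).symm y) u
    = chartSymmDeriv (chartAt E x) y u := by
    have := congrArg (fun L ↦ L u) h5
    rw [Trivialization.symmL_apply _ (by simpa using hy')] at this
    rw [this]
    simp only [extChartAt, OpenPartialHomeomorph.extend, chartSymmDeriv, mfld_simps,
      mfderivWithin_univ]
    rw [(chartAt E x).right_inv hy]
  rw [h6, h6, inChart_apply]
  simp

theorem leviCivita_metric [FiniteDimensional ℝ E] (g : PseudoRiemannianMetric E M)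
    {X Y : Π x : M, TangentSpace 𝓘(ℝ, E) x} {x : M} (hX : MDiffAt (T% X) x) (hY : MDiffAt (T% Y) x)
    (v : TangentSpace 𝓘(ℝ, E) x) :
    mvfderiv 𝓘(ℝ, E) (fun z ↦ g.val z (X z) (Y z)) x v =
      g.val x (g.leviCivita X x v) (Y x) + g.val x (X x) (g.leviCivita Y x v) := by
  have hi := chartDeriv_isInvertible (E := E) x
  have hm : MDiffAt (fun z ↦ g.val z (X z) (Y z)) x := by
    have h1 : MDifferentiableAt 𝓘(ℝ, E) (𝓘(ℝ, E).prod 𝓘(ℝ, ℝ))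
      (fun m ↦ TotalSpace.mk' ℝ (E := Bundle.Trivial M ℝ) m (g.val m (X m) (Y m))) x := by
      apply MDifferentiableAt.clm_bundle_apply₂ (F₁ := E) (F₂ := E)
      · exact g.contMDiff.mdifferentiableAt (by simp)
      · exact hX
      · exact hY
    exact (mdifferentiableAt_totalSpace ..).1 h1 |>.2
  have h1 := hasFDerivAt_comp_chart_symm hm
  have h2 := ((g.inChart_differentiableAt x).hasFDerivAt.clm_apply
    (differentiableAt_vectorInChart hX).hasFDerivAt).clm_apply
    (differentiableAt_vectorInChart hY).hasFDerivAt
  have h3 := h1.unique (h2.congr_of_eventuallyEq (by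
    filter_upwards [(chartAt E x).open_target.mem_nhds (mem_chart_target E x)] with y hy
    rw [vectorInChart, vectorInChart, inChart_apply,
      chartSymmDeriv_chartDeriv (chart_mem_atlas E x) hy,
      chartSymmDeriv_chartDeriv (chart_mem_atlas E x) hy]
    rfl))
  have h4 := congrArg (fun L : E →L[ℝ] ℝ ↦ L (chartDeriv (chartAt E x) x v)) h3
  simp only [ContinuousLinearMap.comp_apply, hi.inverse_apply_self, vectorInChart_self, add_apply,
    ContinuousLinearMap.flip_apply] at h4
  rw [h4]
  change _ = g.val x (g.covAt X x v) (Y x) + g.val x (X x) (g.covAt Y x v)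
  rw [← g.inChart_chartDeriv (chart_mem_atlas E x) (mem_chart_source E x),
    ← g.inChart_chartDeriv (chart_mem_atlas E x) (mem_chart_source E x),
    covAt_apply, covAt_apply, hi.self_apply_inverse, hi.self_apply_inverse,
    vectorInChart_self, vectorInChart_self, map_add, map_add, add_apply,
    g.inChart_christoffel (chart_mem_atlas E x) (mem_chart_target E x),
    g.inChart_symm _ _ _ (g.christoffel _ _ _ _),
    g.inChart_christoffel (chart_mem_atlas E x) (mem_chart_target E x),
    christoffelFirst_apply, christoffelFirst_apply]
  rw [g.inChart_symm _ _ (chartDeriv _ x (X x)) (fderiv _ _ _ _),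
    g.fderiv_inChart_symm _ _ (chartDeriv _ x v) (chartDeriv _ x (Y x))]
  ring

theorem leviCivita_torsion [FiniteDimensional ℝ E] (g : PseudoRiemannianMetric E M) :
    haveI : IsManifold 𝓘(ℝ, E) 2 M := .of_le (n := ∞) (by norm_cast)
    g.leviCivita.torsion = 0 := by
  have : IsManifold 𝓘(ℝ, E) 2 M := .of_le (n := ∞) (by norm_cast)
  rw [CovariantDerivative.torsion_eq_zero_iff]
  intro X Y x hX hY
  have hV (X : Π x : M, TangentSpace 𝓘(ℝ, E) x) :
    VectorField.mpullbackWithin 𝓘(ℝ, E) 𝓘(ℝ, E) (extChartAt 𝓘(ℝ, E) x).symm X (Set.range 𝓘(ℝ, E))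
      =ᶠ[𝓝 (chartAt E x x)] vectorInChart (chartAt E x) X := by
    filter_upwards [(chartAt E x).open_target.mem_nhds (mem_chart_target E x)] with y hy
    rw [VectorField.mpullbackWithin_apply]
    simp only [extChartAt, OpenPartialHomeomorph.extend, mfld_simps, mfderivWithin_univ]
    have h : (chartSymmDeriv (chartAt E x) y).inverse
        = chartDeriv (chartAt E x) ((chartAt E x).symm y) :=
      ContinuousLinearMap.inverse_eq
        (ContinuousLinearMap.ext fun _ ↦ chartSymmDeriv_chartDeriv (chart_mem_atlas E x) hy _)
        (ContinuousLinearMap.ext fun _ ↦ chartDeriv_chartSymmDeriv (chart_mem_atlas E x) hy _)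
    exact congrArg (fun L : TangentSpace 𝓘(ℝ, E) ((chartAt E x).symm y) →L[ℝ] E ↦ L (X _)) h
  change g.covAt Y x (X x) - g.covAt X x (Y x) = _
  rw [covAt_apply, covAt_apply, ← map_sub, vectorInChart_self, vectorInChart_self,
    g.christoffel_symm _ _ (chartDeriv (chartAt E x) x (X x)), add_sub_add_right_eq_sub]

  have h1 : VectorField.mlieBracket 𝓘(ℝ, E) X Y x = (chartDeriv (chartAt E x) x).inverse
      (VectorField.lieBracket ℝ (vectorInChart (chartAt E x) X) (vectorInChart (chartAt E x) Y)
        (chartAt E x x)) := by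
    rw [← Filter.EventuallyEq.lieBracket_vectorField_eq (hV X) (hV Y)]
    simp only [VectorField.mlieBracket, VectorField.mlieBracketWithin, VectorField.mpullback]
    simp only [extChartAt, OpenPartialHomeomorph.extend, mfld_simps, chartDeriv]
    exact congrArg _ (congrFun VectorField.lieBracketWithin_univ _)
  rw [h1, VectorField.lieBracket, vectorInChart_self, vectorInChart_self]

/-- `γ` is a (twice continuously differentiable, affinely parameterized) geodesic of `g` on the open
set `J` of parameters: in every chart it satisfies `γ'' + Γ(γ', γ') = 0`. -/
def IsGeodesicOn (g : PseudoRiemannianMetric E M) (γ : ℝ → M) (J : Set ℝ) : Prop :=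
  ContMDiffOn 𝓘(ℝ, ℝ) 𝓘(ℝ, E) 2 γ J ∧
    ∀ e ∈ atlas E M, ∀ t ∈ J, γ t ∈ e.source →
      deriv (deriv (e ∘ γ)) t
        + g.christoffel e (e (γ t)) (deriv (e ∘ γ) t) (deriv (e ∘ γ) t) = 0

/-- `g'` is geodesically equivalent to `g`: every geodesic `γ` of `g`, defined on an open interval
`J`, is a reparameterized geodesic of `g'`, i.e. `γ = γ' ∘ τ` with `γ'` a geodesic of `g'` on an open
interval `J'` and `τ` a regular change of parameter. -/
def GeodesicallyEquivalent (g g' : PseudoRiemannianMetric E M) : Prop :=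
  ∀ (γ : ℝ → M) (J : Set ℝ), IsOpen J → J.OrdConnected → g.IsGeodesicOn γ J →
    ∃ (γ' : ℝ → M) (J' : Set ℝ) (τ : ℝ → ℝ), IsOpen J' ∧ J'.OrdConnected ∧
      g'.IsGeodesicOn γ' J' ∧ ContDiffOn ℝ 2 τ J ∧ (∀ t ∈ J, deriv τ t ≠ 0) ∧
      Set.MapsTo τ J J' ∧ ∀ t ∈ J, γ t = γ' (τ t)

/-- `g` and `g'` are affinely equivalent: their Levi-Civita connections coincide. -/
def AffinelyEquivalent (g g' : PseudoRiemannianMetric E M) : Prop :=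
  g.leviCivita = g'.leviCivita

/-- The metric `g` is `G`-invariant: every element of `G` acts by isometries. -/
def IsInvariant (G : Type*) [SMul G M] (g : PseudoRiemannianMetric E M) : Prop :=
  ∀ (a : G) (x : M) (v w : TangentSpace 𝓘(ℝ, E) x),
    g.val (a • x) (mfderiv 𝓘(ℝ, E) 𝓘(ℝ, E) (fun z : M ↦ a • z) x v)
      (mfderiv 𝓘(ℝ, E) 𝓘(ℝ, E) (fun z : M ↦ a • z) x w) = g.val x v w

end PseudoRiemannianMetric

end

/-! Let `B = Γ' - Γ` be the difference of the Christoffel symbols of the two metrics in a chart, a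
symmetric bilinear map. An unparameterized geodesic in direction `v` is common to both metrics, so
`B(v, v)` is a multiple of `v` (`exists_christoffel_sub_eq_smul`). Classically this means `B(u, v) =
φ(u) v + φ(v) u` for a covector `φ`, whence `tr B(u, ·) = (n + 1) φ(u)`, and `B` vanishes once these
traces do (`LinearMap.eq_zero_of_forall_trace_eq_zero`, which never constructs `φ`).

The contracted symbol `tr Γ(u, ·)` is half of `tr (g⁻¹ ∂_u g)`, the logarithmic derivative of `det
g` (`trace_christoffel`). So `tr B(u, ·)` is half the logarithmic derivative of `det (g⁻¹ g')`. This
determinant is a scalar function, independent of coordinates and preserved by every common isometry;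
since `G` acts transitively and preserves both metrics, it is constant
(`exists_pullback_inChart_eq`, `ContinuousLinearMap.det_inverse_comp_eq_of_pullback`). Hence all the
traces vanish and `Γ = Γ'`. Signature plays no role, because only nondegeneracy is needed to form
`g⁻¹`. -/

/-! ### Linear algebra: determinants, traces and pure-trace tensors -/

/-- The derivative of the determinant at the identity is the trace. -/
theorem ContinuousLinearMap.hasFDerivAt_det_one {E : Type*} [NormedAddCommGroup E]
    [NormedSpace ℝ E] [FiniteDimensional ℝ E] :
    HasFDerivAt (fun A : E →L[ℝ] E ↦ LinearMap.det (A : E →ₗ[ℝ] E))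
      ((LinearMap.trace ℝ E ∘ₗ ContinuousLinearMap.coeLM ℝ).toContinuousLinearMap) 1 := by
  let b := Module.finBasis ℝ E
  have hdet : (fun A : E →L[ℝ] E ↦ LinearMap.det (A : E →ₗ[ℝ] E)) =
      fun A : E →L[ℝ] E ↦ (LinearMap.toMatrix b b (A : E →ₗ[ℝ] E)).det := by
    funext A
    rw [LinearMap.det_toMatrix]
  have hd : DifferentiableAt ℝ (fun A : E →L[ℝ] E ↦ LinearMap.det (A : E →ₗ[ℝ] E)) 1 := by
    -- By the Leibniz formula the determinant is a sum of products of linear functionals of `A`.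
    rw [hdet]
    simp only [Matrix.det_apply, LinearMap.toMatrix_apply]
    refine DifferentiableAt.fun_sum fun σ _ ↦ DifferentiableAt.const_smul ?_ _
    let ℓ (i : Fin (Module.finrank ℝ E)) : (E →L[ℝ] E) →ₗ[ℝ] ℝ :=
      { toFun := fun A ↦ b.repr (A (b i)) (σ i)
        map_add' := by simp
        map_smul' := by simp }
    exact (HasFDerivAt.finsetProd fun i _ ↦ (ℓ i).toContinuousLinearMap.hasFDerivAt).differentiableAt
  refine hd.hasFDerivAt.congr_fderiv ?_
  ext A
  -- With differentiability known, the derivative is read off on the line `1 + t A`, where the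
  -- determinant is `1 + t tr A + t² q(t)` for a polynomial `q`.
  have h1 : HasDerivAt (fun t : ℝ ↦ (1 : E →L[ℝ] E) + t • A) A 0 := by
    simpa using ((hasDerivAt_id (0 : ℝ)).smul_const A).const_add 1
  have h2 : HasFDerivAt (fun A : E →L[ℝ] E ↦ LinearMap.det (A : E →ₗ[ℝ] E))
    (fderiv ℝ (fun A : E →L[ℝ] E ↦ LinearMap.det (A : E →ₗ[ℝ] E)) 1)
    ((1 : E →L[ℝ] E) + (0 : ℝ) • A) := by
    rw [zero_smul, add_zero]; exact hd.hasFDerivAt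
  have h3 := h2.comp_hasDerivAt (0 : ℝ) h1
  set M := LinearMap.toMatrix b b (A : E →ₗ[ℝ] E) with hM
  have h4 : (fun A : E →L[ℝ] E ↦ LinearMap.det (A : E →ₗ[ℝ] E)) ∘
      (fun t : ℝ ↦ (1 : E →L[ℝ] E) + t • A) = fun t ↦ (1 + t • M).det := by
    funext t
    refine (congrFun hdet _).trans ?_
    simp [hM]
  have h5 : HasDerivAt (fun t : ℝ ↦ (1 + t • M).det) M.trace 0 := by
    rw [funext fun t ↦ Matrix.det_one_add_smul t M]
    have := (((hasDerivAt_id (0 : ℝ)).const_mul M.trace).const_add 1).add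
      ((((1 + (Polynomial.X : Polynomial ℝ) • M.map Polynomial.C).det.divX.divX).hasDerivAt 0).mul
        ((hasDerivAt_id (0 : ℝ)).pow 2))
    refine this.congr_deriv ?_
    simp
  rw [h4] at h3
  have h6 := h3.unique h5
  rw [h6]
  simp [hM, LinearMap.trace_eq_matrix_trace ℝ b]

/-- A symmetric bilinear map `B` with `B(v, v)` a multiple of `v` for all `v`, such that all `B(u, ·)`
are traceless, vanishes. -/
theorem LinearMap.eq_zero_of_forall_trace_eq_zero {E : Type*} [AddCommGroup E] [Module ℝ E]
    [FiniteDimensional ℝ E] (B : E →ₗ[ℝ] E →ₗ[ℝ] E) (hB : ∀ u v, B u v = B v u)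
    (hs : ∀ v, ∃ c : ℝ, B v v = c • v) (ht : ∀ u, LinearMap.trace ℝ E (B u) = 0) : B = 0 := by
  -- Pairing with `α` eliminates the unknown factor `c`, which depends on `v` in an uncontrolled
  -- way; what remains is a polynomial identity of degree 3 in `v`.
  have cubic (α : E →ₗ[ℝ] ℝ) (v : E) : α v • B v v = α (B v v) • v := by
    obtain ⟨c, hc⟩ := hs v
    simp only [hc, map_smul, smul_smul, smul_eq_mul, mul_comm]
  -- This is the part of `cubic` at `v + u` linear in `u`: half the difference of the identities at
  -- `v + u` and `v - u` is the odd part in `u`, and `cubic` at `u` is its cubic term.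
  have polar (α : E →ₗ[ℝ] ℝ) (v u : E) :
      α u • B v v + (2 * α v) • B v u - α (B v v) • u - (2 : ℝ) • α (B v u) • v = 0 := by
    have h1 := cubic α (v + u)
    have h2 := cubic α (v - u)
    have h3 := cubic α u
    simp only [map_add, map_sub, LinearMap.add_apply, LinearMap.sub_apply, hB u v] at h1 h2
    linear_combination (norm := module) (1 / 2 : ℝ) • h1 - (1 / 2 : ℝ) • h2 - h3
  have diag (v : E) : B v v = 0 := by
    rw [← Module.forall_dual_apply_eq_zero_iff ℝ]
    intro α
    -- For fixed `v`, `polar` is an identity of endomorphisms in `u`. Its trace is `(1 - n - 2)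
    -- α(B(v, v)) = 0`, with `n` the dimension, since `B v` is traceless.
    have h1 : α.smulRight (B v v) + (2 * α v) • B v - α (B v v) • LinearMap.id
        - (2 : ℝ) • (α ∘ₗ B v).smulRight v = 0 := by
      ext u
      simpa using polar α v u
    have h2 := congrArg (LinearMap.trace ℝ E) h1
    simp only [map_add, map_sub, map_smul, LinearMap.trace_smulRight, ht, LinearMap.trace_id,
      map_zero, LinearMap.comp_apply, smul_eq_mul, mul_zero] at h2
    have h3 : ((Module.finrank ℝ E : ℝ) + 1) * α (B v v) = 0 := by linarith
    exact (mul_eq_zero.1 h3).resolve_left (by positivity)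
  ext u v
  have h := diag (u + v)
  simp only [map_add, LinearMap.add_apply, diag, hB v u, zero_add, add_zero] at h
  simpa [← two_smul ℝ] using h

/-- The composition of a skew-symmetric form with the inverse of a symmetric form is traceless. -/
theorem LinearEquiv.trace_symm_comp_eq_zero {E : Type*} [AddCommGroup E] [Module ℝ E]
    [FiniteDimensional ℝ E] (b : E ≃ₗ[ℝ] Module.Dual ℝ E) (hb : ∀ u v, b u v = b v u)
    (w : E →ₗ[ℝ] Module.Dual ℝ E) (hw : ∀ u v, w u v = -w v u) :
    LinearMap.trace ℝ E (b.symm.toLinearMap ∘ₗ w) = 0 := by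
  -- The transpose of `b⁻¹ w` is `-w b⁻¹`, the conjugate by `b` of `-b⁻¹ w`; transposition and
  -- conjugation preserve the trace, so the trace is its own negative.
  have h1 : Module.Dual.transpose (R := ℝ) (b.symm.toLinearMap ∘ₗ w) =
      b.conj (-(b.symm.toLinearMap ∘ₗ w)) := by
    ext α v
    obtain ⟨u, rfl⟩ := b.surjective α
    have h2 : b u (b.symm (w v)) = w v u := by rw [hb]; simp
    simp [Module.Dual.transpose_apply, LinearEquiv.conj_apply, h2, hw v u]
  have h2 := congrArg (LinearMap.trace ℝ _) h1
  rw [LinearMap.trace_transpose', LinearMap.trace_conj', map_neg] at h2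
  linarith

/-! ### Smoothness and transformation laws of the metric and Christoffel symbols -/

namespace PseudoRiemannianMetric

variable {E : Type*} [NormedAddCommGroup E] [NormedSpace ℝ E]
  {M : Type*} [TopologicalSpace M] [ChartedSpace E M] [IsManifold 𝓘(ℝ, E) ∞ M]

theorem contDiffOn_transition {e e' : OpenPartialHomeomorph M E} (he : e ∈ atlas E M)
    (he' : e' ∈ atlas E M) :
    ContDiffOn ℝ ∞ (e' ∘ e.symm) (e.symm.trans e').source := by
  have h1 := contMDiffOn_of_mem_maximalAtlas (I := 𝓘(ℝ, E)) (n := ∞)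
    (IsManifold.subset_maximalAtlas he')
  have h2 := contMDiffOn_symm_of_mem_maximalAtlas (I := 𝓘(ℝ, E)) (n := ∞)
    (IsManifold.subset_maximalAtlas he)
  rw [← contMDiffOn_iff_contDiffOn]
  rw [OpenPartialHomeomorph.trans_source]
  exact h1.comp (h2.mono Set.inter_subset_left) fun y hy ↦ hy.2

theorem contDiffAt_transition {e e' : OpenPartialHomeomorph M E} (he : e ∈ atlas E M)
    (he' : e' ∈ atlas E M) {y : E} (hy : y ∈ e.target) (hy' : e.symm y ∈ e'.source) :
    ContDiffAt ℝ ∞ (e' ∘ e.symm) y :=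
  (contDiffOn_transition he he').contDiffAt ((e.symm.trans e').open_source.mem_nhds (by
    rw [OpenPartialHomeomorph.trans_source]; exact ⟨hy, hy'⟩))

theorem chartDeriv_chartSymmDeriv_eq_fderiv {e e' : OpenPartialHomeomorph M E} (he : e ∈ atlas E M)
    (he' : e' ∈ atlas E M) {y : E} (hy : y ∈ e.target) (hy' : e.symm y ∈ e'.source) (u : E) :
    chartDeriv e' (e.symm y) (chartSymmDeriv e y u) = fderiv ℝ (e' ∘ e.symm) y u := by
  have h := mfderiv_comp y (mdifferentiableAt_atlas (I := 𝓘(ℝ, E)) he' hy')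
    (mdifferentiableAt_atlas_symm (I := 𝓘(ℝ, E)) he hy)
  rw [mfderiv_eq_fderiv] at h
  exact (congrArg (fun L : E →L[ℝ] E ↦ L u) h).symm

/-- The transformation law of the components of the metric. -/
theorem inChart_transition (g : PseudoRiemannianMetric E M) {e e' : OpenPartialHomeomorph M E}
    (he : e ∈ atlas E M) (he' : e' ∈ atlas E M) {y : E} (hy : y ∈ e.target)
    (hy' : e.symm y ∈ e'.source) (u v : E) :
    g.inChart e y u v = g.inChart e' ((e' ∘ e.symm) y) (fderiv ℝ (e' ∘ e.symm) y u)
      (fderiv ℝ (e' ∘ e.symm) y v) := by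
  rw [inChart_apply, ← g.inChart_chartDeriv he' hy',
    chartDeriv_chartSymmDeriv_eq_fderiv he he' hy hy',
    chartDeriv_chartSymmDeriv_eq_fderiv he he' hy hy']
  rfl

/-- Smoothness of the section is expressed in the bundle trivialization at `x`, whose frame over the
preferred chart is the coordinate frame; hence the trivialized metric is `inChart` near the base
point. -/
theorem contDiffAt_inChart_chartAt (g : PseudoRiemannianMetric E M) (x : M) :
    ContDiffAt ℝ ∞ (g.inChart (chartAt E x)) (chartAt E x x) := by
  have h1 := (contMDiffAt_section _).1 (g.contMDiff x)
  have h2 : CMDiffAt ∞ (chartAt E x).symm (chartAt E x x) :=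
    (contMDiffOn_symm_of_mem_maximalAtlas (I := 𝓘(ℝ, E)) (n := ∞)
      (IsManifold.chart_mem_maximalAtlas x)).contMDiffAt
      ((chartAt E x).open_target.mem_nhds (mem_chart_target E x))
  have hx : (chartAt E x).symm (chartAt E x x) = x := (chartAt E x).left_inv (mem_chart_source E x)
  rw [← hx] at h1
  have h3 := h1.comp (chartAt E x x) h2
  rw [contMDiffAt_iff_contDiffAt] at h3
  refine h3.congr_of_eventuallyEq ?_
  filter_upwards [(chartAt E x).open_target.mem_nhds (mem_chart_target E x)] with y hy
  have hy' : (chartAt E x).symm y ∈ (chartAt E x).source := (chartAt E x).map_target hy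
  ext u v
  simp only [Function.comp, hx]
  rw [hom_trivializationAt_apply]
  dsimp only
  rw [inCoordinates_apply_eq₂ (by simpa using hy') (by simpa using hy') (by simp)]
  have h5 := TangentBundle.symmL_trivializationAt (I := 𝓘(ℝ, E)) (x₀ := x) hy'
  have h6 (u : E) : (trivializationAt E (TangentSpace 𝓘(ℝ, E)) x).symm ((chartAt E x).symm y) u
    = chartSymmDeriv (chartAt E x) y u := by
    have := congrArg (fun L ↦ L u) h5
    rw [Trivialization.symmL_apply _ (by simpa using hy')] at this
    rw [this]
    simp only [extChartAt, OpenPartialHomeomorph.extend, chartSymmDeriv, mfld_simps,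
      mfderivWithin_univ]
    rw [(chartAt E x).right_inv hy]
  rw [h6, h6, inChart_apply]
  simp

variable [FiniteDimensional ℝ E]

/-- At each `y` the components in `e` are compared, through the transformation law, with those in
the preferred chart at `e.symm y`, where smoothness is known at the base point. -/
theorem contDiffOn_inChart (g : PseudoRiemannianMetric E M) {e : OpenPartialHomeomorph M E}
    (he : e ∈ atlas E M) : ContDiffOn ℝ ∞ (g.inChart e) e.target := by
  rw [contDiffOn_clm_apply]
  intro u
  rw [contDiffOn_clm_apply]
  intro v y hy
  refine ContDiffAt.contDiffWithinAt ?_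
  set x := e.symm y with hx
  have he' := chart_mem_atlas E x
  have hy' : e.symm y ∈ (chartAt E x).source := mem_chart_source E x
  have hφ := contDiffAt_transition he he' hy hy'
  have hD : ContDiffAt ℝ ∞ (fderiv ℝ (chartAt E x ∘ e.symm)) y := hφ.fderiv_right (by simp)
  have hG : ContDiffAt ℝ ∞ (g.inChart (chartAt E x)) ((chartAt E x ∘ e.symm) y) :=
    g.contDiffAt_inChart_chartAt x
  refine (((hG.comp y hφ).clm_apply (hD.clm_apply (contDiffAt_const (c := u)))).clm_apply
    (hD.clm_apply (contDiffAt_const (c := v)))).congr_of_eventuallyEq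
    (f₁ := fun y ↦ g.inChart e y u v) ?_
  filter_upwards [(e.symm.trans (chartAt E x)).open_source.mem_nhds
    (by rw [OpenPartialHomeomorph.trans_source]; exact ⟨hy, hy'⟩)] with z hz
  rw [OpenPartialHomeomorph.trans_source] at hz
  exact g.inChart_transition he he' hz.1 hz.2 u v

theorem differentiableAt_inChart (g : PseudoRiemannianMetric E M) {e : OpenPartialHomeomorph M E}
    (he : e ∈ atlas E M) {y : E} (hy : y ∈ e.target) : DifferentiableAt ℝ (g.inChart e) y :=
  ((g.contDiffOn_inChart he).contDiffAt (e.open_target.mem_nhds hy)).differentiableAt (by simp)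

theorem contDiffOn_christoffel (g : PseudoRiemannianMetric E M) {e : OpenPartialHomeomorph M E}
    (he : e ∈ atlas E M) : ContDiffOn ℝ ∞ (g.christoffel e) e.target := by
  have hD : ContDiffOn ℝ ∞ (fderiv ℝ (g.inChart e)) e.target :=
    (g.contDiffOn_inChart he).fderiv_of_isOpen e.open_target (by simp)
  have hD' (u v z : E) : ContDiffOn ℝ ∞ (fun y ↦ fderiv ℝ (g.inChart e) y u v z) e.target :=
    ((hD.clm_apply contDiffOn_const).clm_apply contDiffOn_const).clm_apply contDiffOn_const
  have hF (u v : E) : ContDiffOn ℝ ∞ (fun y ↦ g.christoffelFirst e y u v) e.target := by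
    rw [contDiffOn_clm_apply]
    intro z
    simp only [christoffelFirst_apply]
    exact contDiffOn_const.mul (((hD' u v z).add (hD' v u z)).sub (hD' z u v))
  have hI : ContDiffOn ℝ ∞ (fun y ↦ (g.inChart e y).inverse) e.target := fun y hy ↦
    ((g.inChart_isInvertible he hy).contDiffAt_map_inverse).comp_contDiffWithinAt y
      (g.contDiffOn_inChart he y hy)
  rw [contDiffOn_clm_apply]
  intro u
  rw [contDiffOn_clm_apply]
  intro v
  exact hI.clm_apply (hF u v)

/-- The transformation law of the Christoffel symbols. -/
theorem christoffel_transition (g : PseudoRiemannianMetric E M) {e e' : OpenPartialHomeomorph M E}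
    (he : e ∈ atlas E M) (he' : e' ∈ atlas E M) {y : E} (hy : y ∈ e.target)
    (hy' : e.symm y ∈ e'.source) (u : E) :
    fderiv ℝ (e' ∘ e.symm) y (g.christoffel e y u u) =
      g.christoffel e' ((e' ∘ e.symm) y) (fderiv ℝ (e' ∘ e.symm) y u)
        (fderiv ℝ (e' ∘ e.symm) y u) + fderiv ℝ (fderiv ℝ (e' ∘ e.symm)) y u u := by
  set φ : E → E := e' ∘ e.symm
  have hφ : ContDiffAt ℝ ∞ φ y := contDiffAt_transition he he' hy hy'
  have hy₂ : φ y ∈ e'.target := e'.map_source hy'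
  have hφ1 : HasFDerivAt φ (fderiv ℝ φ y) y := (hφ.differentiableAt (by simp)).hasFDerivAt
  have hφ2 : HasFDerivAt (fderiv ℝ φ) (fderiv ℝ (fderiv ℝ φ) y) y :=
    ((hφ.fderiv_right (m := 1) (by norm_cast)).differentiableAt (by simp)).hasFDerivAt
  have hsymm (a b : E) : fderiv ℝ (fderiv ℝ φ) y a b = fderiv ℝ (fderiv ℝ φ) y b a :=
    (hφ.isSymmSndFDerivAt (by simp; norm_cast)).eq a b
  have hev : ∀ᶠ z in 𝓝 y, z ∈ e.target ∧ e.symm z ∈ e'.source := by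
    filter_upwards [(e.symm.trans e').open_source.mem_nhds
      (by rw [OpenPartialHomeomorph.trans_source]; exact ⟨hy, hy'⟩)] with z hz
    rwa [OpenPartialHomeomorph.trans_source] at hz
  -- The derivative of the transformation law of the metric in direction `w`.
  have key (w a b : E) : fderiv ℝ (g.inChart e) y w a b =
      fderiv ℝ (g.inChart e') (φ y) (fderiv ℝ φ y w) (fderiv ℝ φ y a) (fderiv ℝ φ y b)
      + g.inChart e' (φ y) (fderiv ℝ (fderiv ℝ φ) y w a) (fderiv ℝ φ y b)
      + g.inChart e' (φ y) (fderiv ℝ φ y a) (fderiv ℝ (fderiv ℝ φ) y w b) := by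
    have h1 := (((g.differentiableAt_inChart he hy).hasFDerivAt.clm_apply
      (hasFDerivAt_const a y)).clm_apply (hasFDerivAt_const b y))
    have h2 := ((((g.differentiableAt_inChart he' hy₂).hasFDerivAt.comp y hφ1).clm_apply
      (hφ2.clm_apply (hasFDerivAt_const a y))).clm_apply (hφ2.clm_apply (hasFDerivAt_const b y)))
    have h3 := h1.unique (h2.congr_of_eventuallyEq (hev.mono fun z hz ↦
      g.inChart_transition he he' hz.1 hz.2 a b))
    have h4 := congrArg (fun L : E →L[ℝ] ℝ ↦ L w) h3
    simp at h4
    rw [h4]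
    ring
  -- The differential of the transition map pulls a metric back to a nondegenerate form, so its
  -- kernel is trivial.
  have hinj : Function.Injective (fderiv ℝ φ y : E →ₗ[ℝ] E) := by
    rw [injective_iff_map_eq_zero]
    intro w hw
    refine (map_eq_zero_iff _ (g.inChart_isInvertible he hy).injective).1 ?_
    ext z
    rw [g.inChart_transition he he' hy hy', show fderiv ℝ φ y w = 0 from hw]
    simp
  have hsurj : Function.Surjective (fderiv ℝ φ y) := LinearMap.surjective_of_injective hinj
  refine sub_eq_zero.1 ((g.inChart_isInvertible he' hy₂).injective ?_)
  rw [map_zero]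
  ext z
  obtain ⟨z, rfl⟩ : ∃ w, fderiv ℝ φ y w = z := hsurj z
  -- In the Koszul combination the terms with the second derivative in `(u, z)` cancel by symmetry,
  -- leaving only the pairing of the second derivative in `(u, u)` with the image of `z`.
  have h1 := g.inChart_christoffel he hy u u z
  rw [g.inChart_transition he he' hy hy', christoffelFirst_apply, key, key, hsymm z u] at h1
  have h2 := g.inChart_christoffel he' hy₂ (fderiv ℝ φ y u) (fderiv ℝ φ y u) (fderiv ℝ φ y z)
  rw [christoffelFirst_apply] at h2
  have h3 := g.inChart_symm e' (φ y) (fderiv ℝ φ y u) (fderiv ℝ (fderiv ℝ φ) y u z)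
  simp only [map_sub, map_add, sub_apply, add_apply, zero_apply]
  linarith

end PseudoRiemannianMetric

/-! ### Second-order chain rules for curves -/

theorem ContDiffAt.hasDerivAt_deriv {E : Type*} [NormedAddCommGroup E] [NormedSpace ℝ E]
    {c : ℝ → E} {t : ℝ} (hc : ContDiffAt ℝ 2 c t) :
    HasDerivAt (deriv c) (deriv (deriv c) t) t := by
  have h : ContDiffAt ℝ 1 (fun s ↦ fderiv ℝ c s 1) t :=
    (hc.fderiv_right (m := 1) (by norm_num)).clm_apply contDiffAt_const
  exact (h.differentiableAt (by simp)).hasDerivAt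

/-- The second derivative of `φ` appearing here is the inhomogeneous term of the Christoffel
transformation law; this makes the geodesic equation independent of the chart. -/
theorem ContDiffAt.deriv_deriv_comp {E F : Type*} [NormedAddCommGroup E] [NormedSpace ℝ E]
    [NormedAddCommGroup F] [NormedSpace ℝ F] {φ : E → F} {c : ℝ → E} {t : ℝ}
    (hφ : ContDiffAt ℝ 2 φ (c t)) (hc : ContDiffAt ℝ 2 c t) :
    deriv (deriv (φ ∘ c)) t = fderiv ℝ (fderiv ℝ φ) (c t) (deriv c t) (deriv c t)
      + fderiv ℝ φ (c t) (deriv (deriv c) t) := by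
  have h1 : deriv (φ ∘ c) =ᶠ[𝓝 t] fun s ↦ fderiv ℝ φ (c s) (deriv c s) := by
    filter_upwards [hc.eventually (by simp), hc.continuousAt.eventually (hφ.eventually (by simp))]
      with s hs hs'
    exact fderiv_comp_deriv s (hs'.differentiableAt (by simp)) (hs.differentiableAt (by simp))
  have h2 : HasDerivAt c (deriv c t) t := (hc.differentiableAt (by simp)).hasDerivAt
  have h3 : HasDerivAt (deriv c) (deriv (deriv c) t) t :=
    hc.hasDerivAt_deriv
  have h4 : HasFDerivAt (fderiv ℝ φ) (fderiv ℝ (fderiv ℝ φ) (c t)) (c t) :=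
    ((hφ.fderiv_right (m := 1) (by norm_num)).differentiableAt (by simp)).hasFDerivAt
  exact h1.deriv_eq.trans ((h4.comp_hasDerivAt t h2).clm_apply h3).deriv

/-- Reparameterization changes the acceleration, up to scaling, only by a tangential term; this term
is the source of the multiple of `v` in the comparison of Christoffel symbols. -/
theorem ContDiffAt.deriv_deriv_scomp {E : Type*} [NormedAddCommGroup E] [NormedSpace ℝ E]
    {c : ℝ → E} {τ : ℝ → ℝ} {t : ℝ} (hc : ContDiffAt ℝ 2 c (τ t)) (hτ : ContDiffAt ℝ 2 τ t) :
    deriv (deriv (c ∘ τ)) t = deriv τ t ^ 2 • deriv (deriv c) (τ t)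
      + deriv (deriv τ) t • deriv c (τ t) := by
  have h1 : deriv (c ∘ τ) =ᶠ[𝓝 t] fun s ↦ deriv τ s • deriv c (τ s) := by
    filter_upwards [hτ.eventually (by simp), hτ.continuousAt.eventually (hc.eventually (by simp))]
      with s hs hs'
    exact deriv.scomp s (hs'.differentiableAt (by simp)) (hs.differentiableAt (by simp))
  have h2 : HasDerivAt τ (deriv τ t) t := (hτ.differentiableAt (by simp)).hasDerivAt
  have h3 : HasDerivAt (deriv τ) (deriv (deriv τ) t) t :=
    hτ.hasDerivAt_deriv
  have h4 : HasDerivAt (deriv c) (deriv (deriv c) (τ t)) (τ t) :=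
    hc.hasDerivAt_deriv
  refine (h1.deriv_eq.trans (h3.smul (h4.scomp t h2)).deriv).trans ?_
  simp only [Function.comp, smul_smul, sq]

/-! ### Geodesics and the difference of the Christoffel symbols -/

namespace PseudoRiemannianMetric

variable {E : Type*} [NormedAddCommGroup E] [NormedSpace ℝ E]
  {M : Type*} [TopologicalSpace M] [ChartedSpace E M] [IsManifold 𝓘(ℝ, E) ∞ M]

theorem IsGeodesicOn.contDiffAt {g : PseudoRiemannianMetric E M} {γ : ℝ → M} {J : Set ℝ}
    (h : g.IsGeodesicOn γ J) (hJ : IsOpen J) {e : OpenPartialHomeomorph M E} (he : e ∈ atlas E M)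
    {t : ℝ} (ht : t ∈ J) (hte : γ t ∈ e.source) : ContDiffAt ℝ 2 (e ∘ γ) t := by
  have h1 : ContMDiffAt 𝓘(ℝ, E) 𝓘(ℝ, E) 2 e (γ t) :=
    ((contMDiffOn_of_mem_maximalAtlas (I := 𝓘(ℝ, E)) (n := ∞)
      (IsManifold.subset_maximalAtlas he)).contMDiffAt
      (e.open_source.mem_nhds hte)).of_le (by norm_cast)
  rw [← contMDiffAt_iff_contDiffAt]
  exact h1.comp t (h.1.contMDiffAt (hJ.mem_nhds ht))

variable [FiniteDimensional ℝ E]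

/-- A curve that satisfies the geodesic equation in one chart satisfies it in all charts. -/
theorem isGeodesicOn_symm_comp (g : PseudoRiemannianMetric E M) {e : OpenPartialHomeomorph M E}
    (he : e ∈ atlas E M) {c : ℝ → E} {J : Set ℝ} (hJ : IsOpen J) (hc : ContDiffOn ℝ 2 c J)
    (hcJ : Set.MapsTo c J e.target)
    (h : ∀ t ∈ J, deriv (deriv c) t + g.christoffel e (c t) (deriv c t) (deriv c t) = 0) :
    g.IsGeodesicOn (e.symm ∘ c) J := by
  refine ⟨?_, fun e' he' t ht hte' ↦ ?_⟩
  · exact ((contMDiffOn_symm_of_mem_maximalAtlas (I := 𝓘(ℝ, E)) (n := ∞)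
      (IsManifold.subset_maximalAtlas he)).of_le (by norm_cast)).comp hc.contMDiffOn hcJ
  · have hct : ContDiffAt ℝ 2 c t := hc.contDiffAt (hJ.mem_nhds ht)
    have hφ : ContDiffAt ℝ 2 (e' ∘ e.symm) (c t) :=
      (contDiffAt_transition he he' (hcJ ht) hte').of_le (by norm_cast)
    have h1 := hφ.deriv_deriv_comp hct
    have h2 : deriv ((e' ∘ e.symm) ∘ c) t = fderiv ℝ (e' ∘ e.symm) (c t) (deriv c t) :=
      fderiv_comp_deriv t (hφ.differentiableAt (by simp)) (hct.differentiableAt (by simp))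
    rw [eq_neg_of_add_eq_zero_left (h t ht), map_neg,
      g.christoffel_transition he he' (hcJ ht) hte', ← h2] at h1
    change deriv (deriv ((e' ∘ e.symm) ∘ c)) t + _ = 0
    rw [h1]
    change _ + g.christoffel e' ((e' ∘ e.symm) (c t)) (deriv ((e' ∘ e.symm) ∘ c) t)
      (deriv ((e' ∘ e.symm) ∘ c) t) = 0
    abel

/-- There is a geodesic through every point with every initial velocity. -/
theorem exists_isGeodesicOn (g : PseudoRiemannianMetric E M) {e : OpenPartialHomeomorph M E}
    (he : e ∈ atlas E M) {y : E} (hy : y ∈ e.target) (v : E) :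
    ∃ (γ : ℝ → M) (J : Set ℝ), IsOpen J ∧ J.OrdConnected ∧ (0 : ℝ) ∈ J ∧ g.IsGeodesicOn γ J ∧
      γ 0 = e.symm y ∧ deriv (e ∘ γ) 0 = v := by
  -- The geodesic equation as a first-order system in position and velocity, to which the
  -- Picard–Lindelöf theorem applies.
  set f : E × E → E × E := fun p ↦ (p.2, -g.christoffel e p.1 p.2 p.2) with hf
  have hΓ := g.contDiffOn_christoffel he
  have hfc : ContDiffAt ℝ 1 f (y, v) := by
    have h1 : ContDiffAt ℝ 1 (g.christoffel e) (y, v).1 :=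
      (hΓ.contDiffAt (e.open_target.mem_nhds hy)).of_le (by norm_cast)
    exact contDiffAt_snd.prodMk
      (((h1.comp (y, v) contDiffAt_fst).clm_apply contDiffAt_snd).clm_apply contDiffAt_snd).neg
  obtain ⟨α, hα0, ε, hε, hα⟩ :=
    hfc.exists_forall_mem_closedBall_exists_eq_forall_mem_Ioo_hasDerivAt₀ 0
  set c : ℝ → E := fun t ↦ (α t).1 with hc
  set p : ℝ → E := fun t ↦ (α t).2 with hp
  have hαc : ContinuousAt c 0 := (hα 0 (by simp [hε])).continuousAt.fst
  have hc0 : c 0 = y := by simp [hc, hα0]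
  have hp0 : p 0 = v := by simp [hp, hα0]
  -- The interval is shrunk so that the solution stays in the chart.
  have hev : ∀ᶠ t in 𝓝 (0 : ℝ), t ∈ Set.Ioo (0 - ε) (0 + ε) ∧ c t ∈ e.target :=
    (show ∀ᶠ t in 𝓝 (0 : ℝ), t ∈ Set.Ioo (0 - ε) (0 + ε) from
      Ioo_mem_nhds (by linarith) (by linarith)).and
      (hαc.eventually (e.open_target.mem_nhds (by rwa [hc0])))
  obtain ⟨δ, hδ, hδJ⟩ := Metric.eventually_nhds_iff_ball.1 hev
  rw [Real.ball_eq_Ioo] at hδJ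
  set J := Set.Ioo (0 - δ) (0 + δ) with hJdef
  have hJ : IsOpen J := isOpen_Ioo
  have h0 : (0 : ℝ) ∈ J := by simp [hJdef, hδ]
  have hcd (t : ℝ) (ht : t ∈ J) : HasDerivAt c (p t) t := (hα t (hδJ t ht).1).fst
  have hpd (t : ℝ) (ht : t ∈ J) : HasDerivAt p (-g.christoffel e (c t) (p t) (p t)) t :=
    (hα t (hδJ t ht).1).snd
  have hdc : ∀ t ∈ J, deriv c t = p t := fun t ht ↦ (hcd t ht).deriv
  have hdp : ∀ t ∈ J, deriv p t = -g.christoffel e (c t) (p t) (p t) := fun t ht ↦ (hpd t ht).deriv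
  have hcJ : Set.MapsTo c J e.target := fun t ht ↦ (hδJ t ht).2
  have hcc : ContinuousOn c J := fun t ht ↦ (hcd t ht).continuousAt.continuousWithinAt
  have hpc : ContinuousOn p J := fun t ht ↦ (hpd t ht).continuousAt.continuousWithinAt
  -- Regularity is bootstrapped: the equation makes `p'` continuous, so `p` is `C¹`, and `c' = p`
  -- makes `c` of class `C²`.
  have hp1 : ContDiffOn ℝ 1 p J := by
    rw [show (1 : WithTop ℕ∞) = 0 + 1 by simp, contDiffOn_succ_iff_deriv_of_isOpen hJ]
    refine ⟨fun t ht ↦ (hpd t ht).differentiableAt.differentiableWithinAt, by simp, ?_⟩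
    rw [contDiffOn_zero]
    exact ((((hΓ.continuousOn.comp hcc hcJ).clm_apply hpc).clm_apply hpc).neg).congr hdp
  have hc2 : ContDiffOn ℝ 2 c J := by
    rw [show (2 : WithTop ℕ∞) = 1 + 1 by norm_num, contDiffOn_succ_iff_deriv_of_isOpen hJ]
    exact ⟨fun t ht ↦ (hcd t ht).differentiableAt.differentiableWithinAt, by simp, hp1.congr hdc⟩
  refine ⟨e.symm ∘ c, J, hJ, Set.ordConnected_Ioo, h0,
    g.isGeodesicOn_symm_comp he hJ hc2 hcJ fun t ht ↦ ?_, by simp [hc0], ?_⟩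
  · have h1 : deriv c =ᶠ[𝓝 t] p := by
      filter_upwards [hJ.mem_nhds ht] with s hs using hdc s hs
    rw [h1.deriv_eq, hdc t ht, hdp t ht, neg_add_cancel]
  · have h1 : e ∘ e.symm ∘ c =ᶠ[𝓝 0] c := by
      filter_upwards [hJ.mem_nhds h0] with s hs using e.right_inv (hcJ hs)
    rw [h1.deriv_eq, hdc 0 h0, hp0]

/-- The Christoffel symbols of geodesically equivalent metrics differ, as quadratic forms, by a
multiple of the identity. -/
theorem GeodesicallyEquivalent.exists_christoffel_sub_eq_smul {g g' : PseudoRiemannianMetric E M}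
    (h : g.GeodesicallyEquivalent g') {e : OpenPartialHomeomorph M E} (he : e ∈ atlas E M) {y : E}
    (hy : y ∈ e.target) (v : E) :
    ∃ a : ℝ, g'.christoffel e y v v - g.christoffel e y v v = a • v := by
  obtain ⟨γ, J, hJ, hJc, h0, hγ, hγ0, hv⟩ := g.exists_isGeodesicOn he hy v
  obtain ⟨γ', J', τ, hJ', -, hγ', hτ, hτ', hmaps, hγτ⟩ := h γ J hJ hJc hγ
  have hs : γ 0 ∈ e.source := by rw [hγ0]; exact e.map_target hy
  have hs' : γ' (τ 0) ∈ e.source := by rwa [← hγτ 0 h0]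
  have hy0 : e (γ 0) = y := by rw [hγ0, e.right_inv hy]
  have hτ0 : ContDiffAt ℝ 2 τ 0 := hτ.contDiffAt (hJ.mem_nhds h0)
  have hc' : ContDiffAt ℝ 2 (e ∘ γ') (τ 0) := hγ'.contDiffAt hJ' he (hmaps h0) hs'
  have hev : e ∘ γ =ᶠ[𝓝 0] (e ∘ γ') ∘ τ := by
    filter_upwards [hJ.mem_nhds h0] with s hs
    simp [hγτ s hs]
  have h1 : v = deriv τ 0 • deriv (e ∘ γ') (τ 0) := by
    rw [← hv, hev.deriv_eq]
    exact deriv.scomp 0 (hc'.differentiableAt (by simp)) (hτ0.differentiableAt (by simp))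
  have h2 := hγ.2 e he 0 h0 hs
  rw [hev.deriv.deriv_eq, hc'.deriv_deriv_scomp hτ0, hv, hy0] at h2
  have h3 := hγ'.2 e he (τ 0) (hmaps h0) hs'
  rw [← hγτ 0 h0, hy0] at h3
  have h4 : g'.christoffel e y v v = deriv τ 0 ^ 2 •
      g'.christoffel e y (deriv (e ∘ γ') (τ 0)) (deriv (e ∘ γ') (τ 0)) := by
    rw [h1]
    simp only [map_smul, smul_apply, smul_smul, sq]
  -- Put `w` for the velocity of `γ'` and `a` for its second derivative in the chart. Then `v = τ'
  -- w`, `Γ(v, v) = -(τ'² a + τ'' w)` and `Γ'(v, v) = -τ'² a`, so the difference is `τ'' w = (τ'' /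
  -- τ') v`.
  refine ⟨deriv (deriv τ) 0 / deriv τ 0, ?_⟩
  rw [h4, eq_neg_of_add_eq_zero_right h2, eq_neg_of_add_eq_zero_right h3, h1]
  have h5 := hτ' 0 h0
  rw [smul_smul, div_mul_cancel₀ _ h5]
  module

end PseudoRiemannianMetric

/-! ### Relative determinants and their logarithmic derivatives -/

/-- If the determinant of `(G z)⁻¹ G' z` is locally constant, then the logarithmic derivatives of the
determinants of `G` and `G'` agree. -/
theorem HasFDerivAt.trace_inverse_comp_eq {E F : Type*} [NormedAddCommGroup E] [NormedSpace ℝ E]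
    [FiniteDimensional ℝ E] [NormedAddCommGroup F] [NormedSpace ℝ F] {G G' : E → E →L[ℝ] F}
    {D D' : E →L[ℝ] E →L[ℝ] F} {y : E} (hG : HasFDerivAt G D y) (hG' : HasFDerivAt G' D' y)
    (hi : ∀ᶠ z in 𝓝 y, (G z).IsInvertible) (hi' : (G' y).IsInvertible)
    (hdet : ∀ᶠ z in 𝓝 y, LinearMap.det (((G z).inverse ∘L G' z : E →L[ℝ] E) : E →ₗ[ℝ] E) =
      LinearMap.det (((G y).inverse ∘L G' y : E →L[ℝ] E) : E →ₗ[ℝ] E)) (u : E) :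
    LinearMap.trace ℝ E ((G y).inverse ∘L D u : E →L[ℝ] E) =
      LinearMap.trace ℝ E ((G' y).inverse ∘L D' u : E →L[ℝ] E) := by
  have hy := hi.self_of_nhds
  -- Normalizing by `H y` turns the logarithmic derivative into the derivative of the determinant at
  -- the identity, with no basis and no sign of `det H` to choose.
  have hderiv {H : E → E →L[ℝ] F} {K : E →L[ℝ] E →L[ℝ] F} (hH : HasFDerivAt H K y)
      (hHy : (H y).IsInvertible) :
      HasDerivAt (fun t : ℝ ↦
        LinearMap.det (((H y).inverse ∘L H (y + t • u) : E →L[ℝ] E) : E →ₗ[ℝ] E))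
        (LinearMap.trace ℝ E ((H y).inverse ∘L K u : E →L[ℝ] E)) 0 := by
    have h0 : HasDerivAt (fun t : ℝ ↦ y + t • u) u 0 := by
      simpa using ((hasDerivAt_id (0 : ℝ)).smul_const u).const_add y
    have h1 : HasFDerivAt H K (y + (0 : ℝ) • u) := by simpa using hH
    have h2 := ((ContinuousLinearMap.compL ℝ E F E (H y).inverse).hasFDerivAt).comp_hasDerivAt
      (0 : ℝ) (h1.comp_hasDerivAt (0 : ℝ) h0)
    have h3 : (H y).inverse ∘L H (y + (0 : ℝ) • u) = 1 := by
      ext v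
      simp [hHy.inverse_apply_self]
    have h4 : HasFDerivAt (fun A : E →L[ℝ] E ↦ LinearMap.det (A : E →ₗ[ℝ] E)) _
        ((H y).inverse ∘L H (y + (0 : ℝ) • u)) := h3 ▸ ContinuousLinearMap.hasFDerivAt_det_one
    exact h4.comp_hasDerivAt (0 : ℝ) h2
  refine (hderiv hG hy).unique ((hderiv hG' hi').congr_of_eventuallyEq ?_)
  have ht : Filter.Tendsto (fun t : ℝ ↦ y + t • u) (𝓝 0) (𝓝 y) := by
    have : Continuous (fun t : ℝ ↦ y + t • u) := by fun_prop
    simpa using this.tendsto 0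
  filter_upwards [ht.eventually (hi.and hdet)] with t ⟨h1, h2⟩
  set z := y + t • u
  -- Both sides equal `(G y)⁻¹ G' z`. Taking determinants and cancelling the constant `det ((G y)⁻¹
  -- G' y)`, nonzero by `e2`, shows that the two normalized determinants agree near `y`.
  have e1 : ((G y).inverse ∘L G z) ∘L ((G z).inverse ∘L G' z) =
      ((G y).inverse ∘L G' y) ∘L ((G' y).inverse ∘L G' z) := by
    ext v
    simp [h1.self_apply_inverse, hi'.self_apply_inverse]
  have e2 : ((G' y).inverse ∘L G y) ∘L ((G y).inverse ∘L G' y) = 1 := by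
    ext v
    simp [hy.self_apply_inverse, hi'.inverse_apply_self]
  have e3 := congrArg (fun A : E →L[ℝ] E ↦ LinearMap.det (A : E →ₗ[ℝ] E)) e1
  have e4 := congrArg (fun A : E →L[ℝ] E ↦ LinearMap.det (A : E →ₗ[ℝ] E)) e2
  rw [ContinuousLinearMap.toLinearMap_comp, LinearMap.det_comp,
    ContinuousLinearMap.toLinearMap_comp ((G y).inverse ∘L G' y), LinearMap.det_comp, h2,
    mul_comm] at e3
  rw [ContinuousLinearMap.toLinearMap_comp, LinearMap.det_comp,
    ContinuousLinearMap.toLinearMap_one, map_one] at e4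
  exact mul_left_cancel₀ (right_ne_zero_of_mul_eq_one e4) e3

/-- The determinant of one bilinear form relative to another is invariant under pullback. -/
theorem ContinuousLinearMap.det_inverse_comp_eq_of_pullback {E : Type*} [NormedAddCommGroup E]
    [NormedSpace ℝ E] [FiniteDimensional ℝ E] {b b' c c' : E →L[ℝ] E →L[ℝ] ℝ} (hb : b.IsInvertible)
    (hc : c.IsInvertible) (L : E →L[ℝ] E) (h : ∀ u v, c (L u) (L v) = b u v)
    (h' : ∀ u v, c' (L u) (L v) = b' u v) :
    LinearMap.det ((c.inverse ∘L c' : E →L[ℝ] E) : E →ₗ[ℝ] E) =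
      LinearMap.det ((b.inverse ∘L b' : E →L[ℝ] E) : E →ₗ[ℝ] E) := by
  have hinj : Function.Injective (L : E →ₗ[ℝ] E) := by
    rw [injective_iff_map_eq_zero]
    intro w hw
    refine (map_eq_zero_iff _ hb.injective).1 ?_
    ext z
    rw [← h, show L w = 0 from hw]
    simp
  have hsurj : Function.Surjective (L : E →ₗ[ℝ] E) := LinearMap.surjective_of_injective hinj
  -- `L`, invertible because `b` is nondegenerate, conjugates `b⁻¹ b'` into `c⁻¹ c'`.
  have key : L ∘L (b.inverse ∘L b') = (c.inverse ∘L c') ∘L L := by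
    ext u
    refine hc.injective ?_
    ext w
    obtain ⟨v, rfl⟩ : ∃ v, L v = w := hsurj w
    simp [h, h', hb.self_apply_inverse, hc.self_apply_inverse]
  have hdet := congrArg (fun A : E →L[ℝ] E ↦ LinearMap.det (A : E →ₗ[ℝ] E)) key
  rw [ContinuousLinearMap.toLinearMap_comp, LinearMap.det_comp,
    ContinuousLinearMap.toLinearMap_comp (c.inverse ∘L c'), LinearMap.det_comp, mul_comm] at hdet
  have hL : LinearMap.det (L : E →ₗ[ℝ] E) ≠ 0 :=
    (LinearMap.isUnit_det _ ((Module.End.isUnit_iff _).2 ⟨hinj, hsurj⟩)).ne_zero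
  exact (mul_right_cancel₀ hL hdet).symm

/-! ### Homogeneity and the contracted Christoffel symbols -/

namespace PseudoRiemannianMetric

variable {E : Type*} [NormedAddCommGroup E] [NormedSpace ℝ E]
  {M : Type*} [TopologicalSpace M] [ChartedSpace E M] [IsManifold 𝓘(ℝ, E) ∞ M]

/-- On a homogeneous space any two points of a chart are related by an isometry, for all invariant
metrics simultaneously. -/
theorem exists_pullback_inChart_eq {G : Type*} [Group G]
    [MulAction G M] [MulAction.IsPretransitive G M] {e : OpenPartialHomeomorph M E}
    (he : e ∈ atlas E M) {y z : E} (hz : z ∈ e.target) :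
    ∃ L : E →L[ℝ] E, ∀ g : PseudoRiemannianMetric E M, g.IsInvariant G →
      ∀ u v, g.inChart e z (L u) (L v) = g.inChart e y u v := by
  obtain ⟨a, ha⟩ := MulAction.exists_smul_eq G (e.symm y) (e.symm z)
  have hs : a • e.symm y ∈ e.source := ha ▸ e.map_target hz
  have hez : e (a • e.symm y) = z := by rw [ha, e.right_inv hz]
  refine ⟨chartDeriv e (a • e.symm y) ∘L
    (mfderiv 𝓘(ℝ, E) 𝓘(ℝ, E) (fun x : M ↦ a • x) (e.symm y) ∘L chartSymmDeriv e y),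
    fun g hg u v ↦ ?_⟩
  rw [← hez]
  exact (g.inChart_chartDeriv he hs _ _).trans (hg a _ _ _)

variable [FiniteDimensional ℝ E]

/-- The contraction of the Christoffel symbols is half the logarithmic derivative of the determinant
of the metric. -/
theorem trace_christoffel (g : PseudoRiemannianMetric E M) {e : OpenPartialHomeomorph M E}
    (he : e ∈ atlas E M) {y : E} (hy : y ∈ e.target) (u : E) :
    LinearMap.trace ℝ E (g.christoffel e y u : E →ₗ[ℝ] E) = 1 / 2 *
      LinearMap.trace ℝ E ((g.inChart e y).inverse ∘L fderiv ℝ (g.inChart e) y u : E →L[ℝ] E) := by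
  obtain ⟨L, hL⟩ := g.inChart_isInvertible he hy
  set D := fderiv ℝ (g.inChart e) y with hD
  let b : E ≃ₗ[ℝ] Module.Dual ℝ E := L.toLinearEquiv.trans LinearMap.toContinuousLinearMap.symm
  -- For fixed `u`, the symbol of the first kind is half of `∂_u g(v, z)` plus half of `w(v, z)`. As
  -- `w` is skew in `v` and `z`, it is traceless after raising an index.
  let w : E →ₗ[ℝ] Module.Dual ℝ E := LinearMap.mk₂ ℝ (fun v z ↦ D v u z - D z u v)
    (by intros; simp; ring) (by intros; simp; ring) (by intros; simp; ring) (by intros; simp; ring)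
  have hw := b.trace_symm_comp_eq_zero (fun u v ↦ by
    have := g.inChart_symm e y u v
    rw [← hL] at this
    exact this) w (fun v z ↦ by simp [w])
  have h : (g.christoffel e y u : E →ₗ[ℝ] E) =
      (1 / 2 : ℝ) • (((g.inChart e y).inverse ∘L D u : E →L[ℝ] E) : E →ₗ[ℝ] E)
      + (1 / 2 : ℝ) • (b.symm.toLinearMap ∘ₗ w) := by
    ext v
    have h1 : g.christoffelFirst e y u v = (1 / 2 : ℝ) • D u v
        + (1 / 2 : ℝ) • LinearMap.toContinuousLinearMap (w v) := by
      ext z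
      rw [christoffelFirst_apply]
      simp [w, ← hD]
      ring
    change g.christoffel e y u v = _
    rw [christoffel_apply, h1, ← hL, ContinuousLinearMap.inverse_equiv]
    simp [b]
  rw [h, map_add, map_smul, map_smul, hw]
  simp

end PseudoRiemannianMetric

/-! ### The main theorem -/

/-- Here `M` is a homogeneous space of the Lie group `G`, that is, a smooth manifold with a smooth
transitive action of `G`; the quotient `G ⧸ H` by a closed subgroup, with its quotient topology and
smooth structure, is such a space. -/
theorem theorem1
    {F : Type*} [NormedAddCommGroup F] [NormedSpace ℝ F] [FiniteDimensional ℝ F]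
    {G : Type*} [TopologicalSpace G] [ChartedSpace F G] [Group G] [LieGroup 𝓘(ℝ, F) ∞ G]
    {E : Type*} [NormedAddCommGroup E] [NormedSpace ℝ E] [FiniteDimensional ℝ E]
    {M : Type*} [TopologicalSpace M] [T2Space M] [ChartedSpace E M] [IsManifold 𝓘(ℝ, E) ∞ M]
    [MulAction G M] [ContMDiffSMul 𝓘(ℝ, F) 𝓘(ℝ, E) ∞ G M] [MulAction.IsPretransitive G M]
    (g g' : PseudoRiemannianMetric E M) (hg : g.IsInvariant G) (hg' : g'.IsInvariant G)
    (h : g.GeodesicallyEquivalent g') :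
    g.AffinelyEquivalent g' := by
  have key (e : OpenPartialHomeomorph M E) (he : e ∈ atlas E M) (y : E) (hy : y ∈ e.target) :
      g.christoffel e y = g'.christoffel e y := by
    have hdet : ∀ᶠ z in 𝓝 y,
        LinearMap.det (((g.inChart e z).inverse ∘L g'.inChart e z : E →L[ℝ] E) : E →ₗ[ℝ] E) =
        LinearMap.det (((g.inChart e y).inverse ∘L g'.inChart e y : E →L[ℝ] E) : E →ₗ[ℝ] E) := by
      filter_upwards [e.open_target.mem_nhds hy] with z hz
      obtain ⟨L, hL⟩ := PseudoRiemannianMetric.exists_pullback_inChart_eq (G := G) he (y := y) hz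
      exact ContinuousLinearMap.det_inverse_comp_eq_of_pullback (g.inChart_isInvertible he hy)
        (g.inChart_isInvertible he hz) L (hL g hg) (hL g' hg')
    have htrace := (g.differentiableAt_inChart he hy).hasFDerivAt.trace_inverse_comp_eq
      (g'.differentiableAt_inChart he hy).hasFDerivAt
      ((e.open_target.eventually_mem hy).mono fun z hz ↦
        g.inChart_isInvertible he hz) (g'.inChart_isInvertible he hy) hdet
    let B : E →ₗ[ℝ] E →ₗ[ℝ] E := ContinuousLinearMap.coeLM ℝ ∘ₗ
      ((g'.christoffel e y - g.christoffel e y : E →L[ℝ] E →L[ℝ] E) : E →ₗ[ℝ] E →L[ℝ] E)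
    have hB : B = 0 := by
      refine B.eq_zero_of_forall_trace_eq_zero (fun u v ↦ ?_)
        (h.exists_christoffel_sub_eq_smul he hy) (fun u ↦ ?_)
      · change g'.christoffel e y u v - g.christoffel e y u v =
          g'.christoffel e y v u - g.christoffel e y v u
        rw [g.christoffel_symm, g'.christoffel_symm]
      · change LinearMap.trace ℝ E ((g'.christoffel e y u : E →ₗ[ℝ] E) - g.christoffel e y u) = 0
        rw [map_sub, g.trace_christoffel he hy, g'.trace_christoffel he hy, htrace, sub_self]
    ext u v
    exact (sub_eq_zero.1 (congrArg (fun B : E →ₗ[ℝ] E →ₗ[ℝ] E ↦ B u v) hB)).symm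
  -- In the preferred chart the covariant derivative depends on the metric only through its
  -- Christoffel symbols.
  refine CovariantDerivative.ext ?_
  funext X x
  ext v
  change g.covAt X x v = g'.covAt X x v
  rw [PseudoRiemannianMetric.covAt_apply, PseudoRiemannianMetric.covAt_apply,
    key _ (chart_mem_atlas E x) _ (mem_chart_target E x)]
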